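/- Let $n\ge 1$, $k\ge 0$, let $|\cdot|$ be the infinity norm on $\mathbb R^n$, let $f:\mathbb R^n\to\mathbb R^n$ and $b:\mathbb R^n\to\mathbb R^{n\times k}$ be locally Lipschitz, and let $0\le\vartheta_1<\vartheta_2$. Let $W\subseteq\mathbb R^n$ (the bounded working space) admit a finite partition into boxes (products of bounded nondegenerate intervals), let $\mathcal X=W\cup\{\Delta\}$, where the single state $\Delta$ stands for all points outside $W$, let $\Pi$ be a finite set of atomic propositions, and let $L:\mathcal X\to 2^\Pi$ be a measurable labelling that is constant on every cell of some finite partition of $W$ into boxes. Fix an initial state $x_0\in\mathcal X$. Consider $X_{t+1}=f(X_t)+b(X_t)w_t+\vartheta\xi_t$ with $w_t\sim\mathcal N(0,I_k)$, stopped on leaving $W$. Let $\tilde{[\![\mathcal T]\!]}_1$ be the set of Markov kernels $\mathcal T$ on $\mathcal X$ with $\mathcal T(\Delta,\{\Delta\})=1$ such that for every $x\in W$ there is $u\in\mathbb R^n$, $|u|\le 1$, for which $\mathcal T(x,\cdot)$ is the law of $f(x)+b(x)w+\vartheta_1u$, $w\sim\mathcal N(0,I_k)$, with all mass outside $W$ moved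 to $\Delta$ (point-mass perturbations of intensity $\vartheta_1$). Let $\tilde{[\![\mathcal T]\!]}_2$ be the set of Markov kernels $\mathcal T$ on $\mathcal X$ with $\mathcal T(\Delta,\{\Delta\})=1$ such that for every $x\in W$ there is a pair $(w,\xi)$ of random vectors, with some joint law (not necessarily independent), $w\sim\mathcal N(0,I_k)$ and $\mathbb E|\xi|\le1$, for which $\mathcal T(x,\cdot)$ is the law of $f(x)+b(x)w+\vartheta_2\xi$ with all mass outside $W$ moved to $\Delta$ (general $\mathcal L_1$-perturbations of intensity $\vartheta_2$). Put $\mathbb X_i=(\mathcal X,\tilde{[\![\mathcal T]\!]}_i,x_0,\Pi,L)$, $i=1,2$. Then there exist a finite partition of $W$ into boxes $q_1,\dots,q_N$, a relation $\gamma_\alpha\subseteq\mathfrak P(\mathcal X)\times\mathfrak P(Q)$, where $Q=\{q_1,\dots,q_N,\Delta\}$ and $\alpha\subseteq\mathcal X\times Q$ is the relation $\{(x,q_j):x\in q_j\}\cup\{(\Delta,\Delta)\}$, and a finite-state system $\mathbb I=(Q,[\![\Theta]\!],q_0,\Pi,L_{\mathbb I})$ with $(x_0,q_0)\in\alpha$,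 where $[\![\Theta]\!]$ is a collection of stochastic $Q\times Q$ matrices, such that $$\mathbb X_1\preceq_{\gamma_\alpha}\mathbb I,\qquad \mathbb I\preceq_{\gamma_\alpha^{-1}}\mathbb X_2 .$$ That is: $L_{\mathbb I}(q)=L(x)$ for all $(x,q)\in\alpha$, and 1. for all $q\in Q$, $\mathcal T\in\tilde{[\![\mathcal T]\!]}_1$ and $x\in\alpha^{-1}(q)$ there is $\Theta\in[\![\Theta]\!]$ with $(\mathcal T(x,\cdot),\Theta_q)\in\gamma_\alpha$ and $\mathcal T(x,\alpha^{-1}(q'))=\Theta_{qq'}$ for all $q'\in Q$; 2. for all $q\in Q$, $\Theta\in[\![\Theta]\!]$ and $x\in\alpha^{-1}(q)$ there is $\mathcal T\in\tilde{[\![\mathcal T]\!]}_2$ with $(\mathcal T(x,\cdot),\Theta_q)\in\gamma_\alpha$ and $\mathcal T(x,\alpha^{-1}(q'))=\Theta_{qq'}$ for all $q'\in Q$. Moreover, $\gamma_\alpha$ can be chosen to contain only pairs $(\nu,\mu)$ with $\nu(\alpha^{-1}(q))=\mu(q)$ for all $q\in Q$, and $[\![\Theta]\!]$ can be chosen to be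 given by finitely many interval bounds: for every $q\in Q$ there are finitely many pairs of lower and upper bound vectors, and $[\![\Theta]\!]$ consists of all stochastic matrices each of whose rows $\Theta_q$ lies componentwise between the bounds of one of the pairs belonging to $q$ (a finite union of interval-valued Markov chains). -/

import Mathlib

open MeasureTheory ProbabilityTheory
open scoped Matrix

/-! ### Markov systems and abstractions -/

/-- Markov (probability) transition kernels on a measurable state space. -/
abbrev MarkovTransition (S : Type*) [MeasurableSpace S] : Type _ :=
  {T : Kernel S S // IsMarkovKernel T}

/-- The transition probability from the state `x`, as a probability measure. -/
def MarkovTransition.law {S : Type*} [MeasurableSpace S] (T : MarkovTransition S) (x : S) :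
    ProbabilityMeasure S :=
  ⟨T.1 x, T.2.isProbabilityMeasure x⟩

/-- A (continuous-state) labelled Markov system: a collection of transition probabilities, an
initial state, and a measurable labelling by sets of atomic propositions. -/
structure MarkovSystem (S AP : Type*) [MeasurableSpace S] where
  /-- the collection of transition probabilities -/
  transitions : Set (MarkovTransition S)
  /-- the initial state -/
  init : S
  /-- the labelling function -/
  label : S → Set AP
  measurable_label : Measurable label

/-- The `i`-th row of a stochastic matrix, as a probability vector. -/
def stochasticRow {Q : Type*} [Fintype Q] [DecidableEq Q] (Θ : Matrix.rowStochastic ℝ Q) (i : Q) :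
    stdSimplex ℝ Q :=
  ⟨fun j => Θ.1 i j, fun j => Matrix.nonneg_of_mem_rowStochastic Θ.2,
    Matrix.sum_row_of_mem_rowStochastic Θ.2 i⟩

/-- A finite-state labelled Markov system: a collection of stochastic matrices, an initial state
and a labelling. -/
structure FiniteMarkovSystem (Q AP : Type*) [Fintype Q] [DecidableEq Q] where
  /-- the collection of transition matrices -/
  transitions : Set (Matrix.rowStochastic ℝ Q)
  /-- the initial state -/
  init : Q
  /-- the labelling function -/
  label : Q → Set AP

/-- A state-level abstraction: the relation `α` is total and respects the labels. -/
def IsStateAbstraction {S Q AP : Type*} [MeasurableSpace S] [Fintype Q] [DecidableEq Q]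
    (X : MarkovSystem S AP) (I : FiniteMarkovSystem Q AP) (α : SetRel S Q) : Prop :=
  (∀ x, ∃ q, (x, q) ∈ α) ∧ ∀ x q, (x, q) ∈ α → I.label q = X.label x

/-- The probability measure `ν` and the probability vector `μ` agree on the discrete nodes:
`ν (α⁻¹(q)) = μ q` for all `q`. -/
def AgreeOnNodes {S Q : Type*} [MeasurableSpace S] [Fintype Q] (α : SetRel S Q)
    (ν : ProbabilityMeasure S) (μ : stdSimplex ℝ Q) : Prop :=
  ∀ q, ((ν {x | (x, q) ∈ α} : NNReal) : ℝ) = μ.1 q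

/-- `X ⪯_γ I`: the finite-state system `I` abstracts the continuous-state system `X` through the
state-level relation `α` and the measure-level relation `γ`. -/
def AbstractedByFinite {S Q AP : Type*} [MeasurableSpace S] [Fintype Q] [DecidableEq Q]
    (X : MarkovSystem S AP) (I : FiniteMarkovSystem Q AP) (α : SetRel S Q)
    (γ : SetRel (ProbabilityMeasure S) (stdSimplex ℝ Q)) : Prop :=
  IsStateAbstraction X I α ∧
    ∀ i, ∀ T ∈ X.transitions, ∀ x, (x, i) ∈ α →
      ∃ Θ ∈ I.transitions, (T.law x, stochasticRow Θ i) ∈ γ ∧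
        AgreeOnNodes α (T.law x) (stochasticRow Θ i)

/-- `I ⪯_γ X`: the continuous-state system `X` abstracts the finite-state system `I` through the
state-level relation `α` (from the states of `X` to those of `I`) and the measure-level relation
`γ`. -/
def FiniteAbstractedBy {S Q AP : Type*} [MeasurableSpace S] [Fintype Q] [DecidableEq Q]
    (I : FiniteMarkovSystem Q AP) (X : MarkovSystem S AP) (α : SetRel S Q)
    (γ : SetRel (stdSimplex ℝ Q) (ProbabilityMeasure S)) : Prop :=
  IsStateAbstraction X I α ∧
    ∀ i, ∀ Θ ∈ I.transitions, ∀ x, (x, i) ∈ α →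
      ∃ T ∈ X.transitions, (stochasticRow Θ i, T.law x) ∈ γ ∧
        AgreeOnNodes α (T.law x) (stochasticRow Θ i)

/-- The transition matrices are given by interval bounds: for every state `i` there are finitely
many pairs of lower and upper bounds, and the collection consists of all stochastic matrices whose
`i`-th row lies, for every `i`, componentwise between the bounds of one of these pairs (so it is a
finite union of interval-valued Markov chains). -/
def FiniteMarkovSystem.HasIntervalRows {Q AP : Type*} [Fintype Q] [DecidableEq Q]
    (I : FiniteMarkovSystem Q AP) : Prop :=
  ∃ B : Q → Finset ((Q → ℝ) × (Q → ℝ)),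
    I.transitions = {Θ | ∀ i, ∃ p ∈ B i, ∀ j, p.1 j ≤ Θ.1 i j ∧ Θ.1 i j ≤ p.2 j}

/-! ### Rectangular partitions -/

/-- A box: a product of bounded nondegenerate intervals (each open, closed or half-open). -/
def IsBox {n : ℕ} (s : Set (Fin n → ℝ)) : Prop :=
  ∃ J : Fin n → Set ℝ,
    (∀ i, (J i).OrdConnected ∧ (J i).Nontrivial ∧ Bornology.IsBounded (J i)) ∧
      s = Set.univ.pi J

/-- A finite partition of the set `W` into boxes. -/
def IsRectPartition {n N : ℕ} (W : Set (Fin n → ℝ)) (cells : Fin N → Set (Fin n → ℝ)) : Prop :=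
  (∀ j, IsBox (cells j)) ∧ Pairwise (fun i j => Disjoint (cells i) (cells j)) ∧ ⋃ j, cells j = W

/-- The state-level relation of a partition of `W`: a state `x` of `W` is related to (the index
of) the cell that contains it, and the out-of-domain state `Δ = Sum.inr ()` to the out-of-domain
node `Δ = Sum.inr ()`. -/
def partitionRel {n N : ℕ} (W : Set (Fin n → ℝ)) (cells : Fin N → Set (Fin n → ℝ)) :
    SetRel (W ⊕ Unit) (Fin N ⊕ Unit) :=
  {p | (∃ x j, p = (Sum.inl x, Sum.inl j) ∧ (x : Fin n → ℝ) ∈ cells j) ∨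
    p = (Sum.inr (), Sum.inr ())}

/-- The labelling function is amenable to a rectangular partition: it is constant on the cells of
some rectangular partition of `W`. -/
def AmenableToRectPartition {n : ℕ} {AP : Type*} (W : Set (Fin n → ℝ))
    (L : W ⊕ Unit → Set AP) : Prop :=
  ∃ (N : ℕ) (cells : Fin N → Set (Fin n → ℝ)), IsRectPartition W cells ∧
    ∀ j, ∀ x y : W, (x : Fin n → ℝ) ∈ cells j → (y : Fin n → ℝ) ∈ cells j →
      L (Sum.inl x) = L (Sum.inl y)

/-! ### Perturbed Gaussian systems -/

/-- The standard Gaussian distribution `N(0, I)` on `ℝᵏ`. -/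
noncomputable def stdNormal (k : ℕ) : Measure (Fin k → ℝ) :=
  Measure.pi fun _ => gaussianReal 0 1

/-- Joint laws of the pair (Gaussian input `w`, perturbation `ξ`) where `ξ` is a point mass at some
point of the closed unit ball of the infinity norm. -/
def pointMassPerturbation (n k : ℕ) : Set (Measure ((Fin k → ℝ) × (Fin n → ℝ))) :=
  {π | ∃ u : Fin n → ℝ, ‖u‖ ≤ 1 ∧ π = (stdNormal k).prod (Measure.dirac u)}

/-- Joint laws of the pair (Gaussian input `w`, perturbation `ξ`) where `ξ` is an arbitrary random
vector with `𝔼‖ξ‖ ≤ 1` (infinity norm). -/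
def l1Perturbation (n k : ℕ) : Set (Measure ((Fin k → ℝ) × (Fin n → ℝ))) :=
  {π | π.map Prod.fst = stdNormal k ∧ ∫⁻ p, ‖p.2‖ₑ ∂π ≤ 1}

open Classical in
/-- The stopping map: points outside `W` are sent to the out-of-domain state `Δ = Sum.inr ()`. -/
noncomputable def killOutside {n : ℕ} (W : Set (Fin n → ℝ)) (x : Fin n → ℝ) : W ⊕ Unit :=
  if h : x ∈ W then Sum.inl ⟨x, h⟩ else Sum.inr ()

/-- The modified transition probabilities, on `W` together with one absorbing out-of-domain state
`Δ`, of the system `X_{t+1} = f(X_t) + b(X_t) w_t + ϑ ξ_t`: at each `x ∈ W` the law of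
`f x + b x w + ϑ ξ` for some admissible law of `(w, ξ)`, with all the mass outside `W` put on
`Δ`. -/
def perturbedTransitions {n k : ℕ} (W : Set (Fin n → ℝ)) (f : (Fin n → ℝ) → (Fin n → ℝ))
    (b : (Fin n → ℝ) → Matrix (Fin n) (Fin k) ℝ) (ϑ : ℝ)
    (noise : Set (Measure ((Fin k → ℝ) × (Fin n → ℝ)))) : Set (MarkovTransition (W ⊕ Unit)) :=
  {T | (∀ x : W, ∃ π ∈ noise,
      T.1 (Sum.inl x) = π.map fun p => killOutside W (f x + b x *ᵥ p.1 + ϑ • p.2)) ∧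
    T.1 (Sum.inr ()) = Measure.dirac (Sum.inr ())}

/-- The Markov system of the perturbed difference equation with intensity `ϑ`. -/
def perturbedSystem {n k : ℕ} {AP : Type*} (W : Set (Fin n → ℝ))
    (f : (Fin n → ℝ) → (Fin n → ℝ)) (b : (Fin n → ℝ) → Matrix (Fin n) (Fin k) ℝ) (ϑ : ℝ)
    (noise : Set (Measure ((Fin k → ℝ) × (Fin n → ℝ)))) (x₀ : W ⊕ Unit)
    (L : W ⊕ Unit → Set AP) (hL : Measurable L) : MarkovSystem (W ⊕ Unit) AP where
  transitions := perturbedTransitions W f b ϑ noise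
  init := x₀
  label := L
  measurable_label := hL

/-! Everything is read off from node laws: the laws of the cell, or `Δ`, reached in one step. These
need not depend continuously on the state, since `b` may be degenerate and cells have boundaries, so
no continuity of transition probabilities is used. The surplus `ϑ₂ - ϑ₁` pays for every discrepancy
instead, one third for each of three errors.

The labelling partition is refined until `f x + b x w` varies on each cell by at most `ε (1 + ‖w‖)`,
using uniform continuity on the compact closure of `W`. The node laws of all points of a cell under
all `‖u‖ ≤ 1` form a subset of the simplex, which is totally bounded. Finitely many sup-norm boxes
of radius `η`, centred at such laws, cover it (`exists_finset_box_cover`); these are the interval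
bounds, and the first abstraction holds by construction.

For the second, let the row `μ` be `η`-close to the node law of `Y = f x + b x w + ϑ₁ u`, let `y`
share the cell of `x`, and put `V = f y + b y w`. A stochastic matrix moving little mass takes the
node law of `Y` to `μ` (`exists_stochastic_transport`). Given `w`, a target node is drawn from its
row; if it is the node of `Y` the target point is `Y`, otherwise a fixed point of the drawn node.
Then `ξ = (target - V) / ϑ₂` produces exactly `μ`. It depends on `w`, but the marginal of `w` is
unchanged. Jumps have unbounded length because `w` is Gaussian, so their mean is controlled by a
Young inequality and second moments (`exists_perturbation_of_law`, `exists_tolerance`). -/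

/-! ### Subdivision of boxes -/

/-- A bounded nondegenerate interval of length at most `2 ^ m * δ` is a finite disjoint union of
nondegenerate intervals of length at most `δ`. -/
theorem exists_interval_partition (δ : ℝ) (m : ℕ) : ∀ J : Set ℝ, J.OrdConnected → J.Nontrivial →
    (∀ x ∈ J, ∀ y ∈ J, |x - y| ≤ 2 ^ m * δ) →
    ∃ (ι : Type) (_ : Finite ι) (c : ι → Set ℝ),
      (∀ i, (c i).OrdConnected ∧ (c i).Nontrivial ∧ ∀ x ∈ c i, ∀ y ∈ c i, |x - y| ≤ δ) ∧
      Pairwise (fun i j => Disjoint (c i) (c j)) ∧ ⋃ i, c i = J := by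
  induction m with
  | zero =>
    intro J h1 h2 h3
    exact ⟨Unit, inferInstance, fun _ => J, fun _ => ⟨h1, h2, by simpa using h3⟩,
      Subsingleton.pairwise, Set.iUnion_const J⟩
  | succ m ih =>
    intro J h1 h2 h3
    obtain ⟨p, hp, q, hq, hpq⟩ := h2.exists_lt
    have hbb : BddBelow J := ⟨p - 2 ^ (m + 1) * δ, fun x hx => by
      have := abs_le.1 (h3 p hp x hx); linarith [this.2]⟩
    have hba : BddAbove J := ⟨p + 2 ^ (m + 1) * δ, fun x hx => by
      have := abs_le.1 (h3 p hp x hx); linarith [this.1]⟩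
    have hlen : sSup J - sInf J ≤ 2 ^ (m + 1) * δ := by
      have : sSup J ≤ sInf J + 2 ^ (m + 1) * δ := csSup_le ⟨p, hp⟩ fun x hx => by
        have : x - 2 ^ (m + 1) * δ ≤ sInf J := le_csInf ⟨p, hp⟩ fun y hy => by
          have := abs_le.1 (h3 x hx y hy); linarith [this.2]
        linarith
      linarith
    rw [pow_succ] at hlen
    have hlt : sInf J < sSup J := (csInf_le hbb hp).trans_lt (hpq.trans_le (le_csSup hba hq))
    set mid := (sInf J + sSup J) / 2 with hmid
    -- Bisection at the midpoint. Points of `J` strictly on both sides of it keep both halves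
    -- nondegenerate; the midpoint itself goes to the lower half.
    obtain ⟨x, hx, hxm⟩ := exists_lt_of_csInf_lt ⟨p, hp⟩ (show sInf J < mid by linarith)
    obtain ⟨y, hy, hym⟩ := exists_lt_of_lt_csSup ⟨p, hp⟩ (show mid < sSup J by linarith)
    have hz : ∀ z, x ≤ z → z ≤ y → z ∈ J := fun z h h' => h1.out hx hy ⟨h, h'⟩
    obtain ⟨ι, _, c, hc1, hc2, hc3⟩ := ih (J ∩ Set.Iic mid) (h1.inter Set.ordConnected_Iic)
      ⟨x, ⟨hx, hxm.le⟩, mid, ⟨hz _ hxm.le hym.le, Set.mem_Iic.2 le_rfl⟩, hxm.ne⟩ (by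
        rintro u ⟨hu, hum⟩ v ⟨hv, hvm⟩
        have := csInf_le hbb hu
        have := csInf_le hbb hv
        simp only [Set.mem_Iic] at hum hvm
        rw [abs_le]; constructor <;> linarith)
    obtain ⟨ι', _, c', hc1', hc2', hc3'⟩ := ih (J ∩ Set.Ioi mid) (h1.inter Set.ordConnected_Ioi)
      ⟨(mid + y) / 2, ⟨hz _ (by linarith) (by linarith), by simp only [Set.mem_Ioi]; linarith⟩, y,
        ⟨hy, hym⟩, by intro h; linarith⟩ (by
        rintro u ⟨hu, hum⟩ v ⟨hv, hvm⟩
        have := le_csSup hba hu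
        have := le_csSup hba hv
        simp only [Set.mem_Ioi] at hum hvm
        rw [abs_le]; constructor <;> linarith)
    have hd : ∀ i j, Disjoint (c i) (c' j) := fun i j => by
      have h : c i ⊆ J ∩ Set.Iic mid := hc3 ▸ Set.subset_iUnion c i
      have h' : c' j ⊆ J ∩ Set.Ioi mid := hc3' ▸ Set.subset_iUnion c' j
      exact Set.disjoint_left.2 fun z hz hz' =>
        not_lt_of_ge (Set.mem_Iic.1 (h hz).2) (Set.mem_Ioi.1 (h' hz').2)
    refine ⟨ι ⊕ ι', inferInstance, Sum.elim c c', ?_, ?_, ?_⟩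
    · rintro (i | i)
      exacts [hc1 i, hc1' i]
    · rintro (i | i) (j | j) hij
      · exact hc2 (fun h => hij (congrArg _ h))
      · exact hd i j
      · exact (hd j i).symm
      · exact hc2' (fun h => hij (congrArg _ h))
    · rw [Set.iUnion_sum]
      simp only [Sum.elim_inl, Sum.elim_inr]
      rw [hc3, hc3', ← Set.inter_union_distrib_left, Set.Iic_union_Ioi, Set.inter_univ]

/-- A box is a finite disjoint union of boxes of diameter at most `δ`. -/
theorem IsBox.exists_partition {n : ℕ} {s : Set (Fin n → ℝ)} (hs : IsBox s) {δ : ℝ} (hδ : 0 < δ) :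
    ∃ (ι : Type) (_ : Finite ι) (c : ι → Set (Fin n → ℝ)),
      (∀ i, IsBox (c i) ∧ ∀ x ∈ c i, ∀ y ∈ c i, dist x y ≤ δ) ∧
      Pairwise (fun i j => Disjoint (c i) (c j)) ∧ ⋃ i, c i = s := by
  obtain ⟨J, hJ, rfl⟩ := hs
  have key : ∀ a, ∃ (ι : Type) (_ : Finite ι) (c : ι → Set ℝ),
      (∀ i, (c i).OrdConnected ∧ (c i).Nontrivial ∧ ∀ x ∈ c i, ∀ y ∈ c i, |x - y| ≤ δ) ∧
      Pairwise (fun i j => Disjoint (c i) (c j)) ∧ ⋃ i, c i = J a := fun a => by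
    obtain ⟨C, hC⟩ := Metric.isBounded_iff.1 (hJ a).2.2
    obtain ⟨m, hm⟩ := pow_unbounded_of_one_lt (C / δ) one_lt_two
    refine exists_interval_partition δ m (J a) (hJ a).1 (hJ a).2.1 fun x hx y hy => ?_
    have := hC hx hy
    rw [Real.dist_eq] at this
    rw [div_lt_iff₀ hδ] at hm
    linarith
  choose ι hι c hc1 hc2 hc3 using key
  refine ⟨∀ a, ι a, inferInstance, fun g => Set.univ.pi fun a => c a (g a), ?_, ?_, ?_⟩
  · refine fun g => ⟨⟨_, fun a => ⟨(hc1 a _).1, (hc1 a _).2.1, ?_⟩, rfl⟩, fun x hx y hy => ?_⟩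
    · exact (hJ a).2.2.subset (hc3 a ▸ Set.subset_iUnion (c a) (g a))
    · exact (dist_pi_le_iff hδ.le).2 fun a => (hc1 a _).2.2 _ (hx a trivial) _ (hy a trivial)
  · intro g g' hg
    obtain ⟨a, ha⟩ := Function.ne_iff.1 hg
    exact Set.disjoint_left.2 fun x hx hx' =>
      Set.disjoint_left.1 (hc2 a ha) (hx a trivial) (hx' a trivial)
  · ext x
    simp only [Set.mem_iUnion, Set.mem_pi, Set.mem_univ, true_imp_iff, ← hc3]
    exact (Classical.skolem (p := fun a i => x a ∈ c a i)).symm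

/-- Every rectangular partition has a refinement by boxes of diameter at most `δ`. -/
theorem IsRectPartition.exists_refinement {n N : ℕ} {W : Set (Fin n → ℝ)}
    {cells : Fin N → Set (Fin n → ℝ)} (h : IsRectPartition W cells) {δ : ℝ} (hδ : 0 < δ) :
    ∃ (N' : ℕ) (cells' : Fin N' → Set (Fin n → ℝ)), IsRectPartition W cells' ∧
      (∀ j, ∃ i, cells' j ⊆ cells i) ∧ ∀ j, ∀ x ∈ cells' j, ∀ y ∈ cells' j, dist x y ≤ δ := by
  choose ι hι c hc1 hc2 hc3 using fun j => (h.1 j).exists_partition hδ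
  have hsub : ∀ j i, c j i ⊆ cells j := fun j i => hc3 j ▸ Set.subset_iUnion (c j) i
  obtain ⟨N', ⟨e⟩⟩ := Finite.exists_equiv_fin (Σ j, ι j)
  refine ⟨N', fun a => c (e.symm a).1 (e.symm a).2, ⟨fun a => (hc1 _ _).1, ?_, ?_⟩,
    fun a => ⟨_, hsub _ _⟩, fun a => (hc1 _ _).2⟩
  · intro a a' ha
    have ha' : e.symm a ≠ e.symm a' := fun h => ha (e.symm.injective h)
    change Disjoint (c (e.symm a).1 (e.symm a).2) (c (e.symm a').1 (e.symm a').2)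
    generalize e.symm a = p at ha' ⊢
    generalize e.symm a' = p' at ha' ⊢
    obtain ⟨j, i⟩ := p
    obtain ⟨j', i'⟩ := p'
    by_cases hj : j = j'
    · subst hj
      exact hc2 j fun h => ha' (congrArg (Sigma.mk j) h)
    · exact Disjoint.mono (hsub j i) (hsub j' i') (h.2.1 hj)
  · rw [e.symm.surjective.iUnion_comp (fun p : Σ j, ι j => c p.1 p.2), Set.iUnion_sigma, ← h.2.2]
    exact Set.iUnion_congr hc3

theorem IsBox.nonempty {n : ℕ} {s : Set (Fin n → ℝ)} (hs : IsBox s) : s.Nonempty := by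
  obtain ⟨J, hJ, rfl⟩ := hs
  exact Set.univ_pi_nonempty_iff.2 fun i => (hJ i).2.1.nonempty

theorem IsBox.measurableSet {n : ℕ} {s : Set (Fin n → ℝ)} (hs : IsBox s) : MeasurableSet s := by
  obtain ⟨J, hJ, rfl⟩ := hs
  exact MeasurableSet.univ_pi fun i => (hJ i).1.measurableSet

theorem IsBox.isBounded {n : ℕ} {s : Set (Fin n → ℝ)} (hs : IsBox s) : Bornology.IsBounded s := by
  obtain ⟨J, hJ, rfl⟩ := hs
  exact Bornology.IsBounded.pi fun i => (hJ i).2.2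

theorem IsRectPartition.measurableSet {n N : ℕ} {W : Set (Fin n → ℝ)}
    {cells : Fin N → Set (Fin n → ℝ)} (h : IsRectPartition W cells) : MeasurableSet W :=
  h.2.2 ▸ MeasurableSet.iUnion fun j => (h.1 j).measurableSet

theorem IsRectPartition.isBounded {n N : ℕ} {W : Set (Fin n → ℝ)}
    {cells : Fin N → Set (Fin n → ℝ)} (h : IsRectPartition W cells) : Bornology.IsBounded W := by
  rw [← h.2.2, Bornology.isBounded_iUnion]
  exact fun j => (h.1 j).isBounded

/-! ### Transport of mass and construction of the perturbation -/

/-- Two probability vectors are connected by a stochastic matrix that moves at most their `ℓ¹`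
distance. -/
theorem exists_stochastic_transport {Q : Type*} [Fintype Q] [DecidableEq Q] {ν μ : Q → ℝ}
    (hν : ν ∈ stdSimplex ℝ Q) (hμ : μ ∈ stdSimplex ℝ Q) :
    ∃ K : Q → Q → ℝ, (∀ i j, 0 ≤ K i j) ∧ (∀ i, ∑ j, K i j = 1) ∧
      (∀ j, ∑ i, ν i * K i j = μ j) ∧ ∑ i, ν i * (1 - K i i) ≤ ∑ i, |ν i - μ i| := by
  -- Maximal coupling: `min (ν i) (μ i)` stays at `i`, and the surplus of `ν`, of total mass `D`, is
  -- spread in proportion to the deficits. The case `D = 0` is separate because of the division by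
  -- `D`; then `ν = μ` and the identity matrix serves.
  set D := ∑ i, (μ i - min (ν i) (μ i)) with hD
  have he : ∀ i, 0 ≤ μ i - min (ν i) (μ i) := fun i => sub_nonneg.2 (min_le_right _ _)
  have hD0 : 0 ≤ D := Finset.sum_nonneg fun i _ => he i
  have hD' : D = ∑ i, (ν i - min (ν i) (μ i)) := by
    rw [hD, Finset.sum_sub_distrib, Finset.sum_sub_distrib, hν.2, hμ.2]
  have hDle : D ≤ ∑ i, |ν i - μ i| := by
    refine Finset.sum_le_sum fun i _ => ?_
    rcases le_total (ν i) (μ i) with h | h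
    · rw [min_eq_left h, abs_sub_comm]; exact le_abs_self _
    · rw [min_eq_right h, sub_self]; positivity
  rcases hD0.eq_or_lt with h0 | hpos
  · have hle : ∀ i, μ i = min (ν i) (μ i) := fun i => sub_eq_zero.1
      ((Finset.sum_eq_zero_iff_of_nonneg fun i _ => he i).1 h0.symm i (Finset.mem_univ i))
    have hle' : ∀ i, ν i = min (ν i) (μ i) := fun i => sub_eq_zero.1
      ((Finset.sum_eq_zero_iff_of_nonneg fun i _ => sub_nonneg.2 (min_le_left _ _)).1
        (hD' ▸ h0.symm) i (Finset.mem_univ i))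
    refine ⟨fun i j => if i = j then 1 else 0, fun i j => by dsimp only; split_ifs <;> norm_num,
      fun i => by simp, fun j => by simpa using (hle' j).trans (hle j).symm, ?_⟩
    simpa using Finset.sum_nonneg fun i _ => abs_nonneg (ν i - μ i)
  -- The fraction of mass kept at `i`. If `ν i = 0` it is `0` by convention, and `ν i * r i` is
  -- still the minimum.
  · set r : Q → ℝ := fun i => min (ν i) (μ i) / ν i with hr
    have hνr : ∀ i, ν i * r i = min (ν i) (μ i) := fun i => by
      rcases eq_or_ne (ν i) 0 with h | h
      · rw [h, zero_mul, min_eq_left (hμ.1 i)]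
      · exact mul_div_cancel₀ _ h
    have hr0 : ∀ i, 0 ≤ r i := fun i => div_nonneg (le_min (hν.1 i) (hμ.1 i)) (hν.1 i)
    have hr1 : ∀ i, r i ≤ 1 := fun i => div_le_one_of_le₀ (min_le_left _ _) (hν.1 i)
    have hq : ∀ i j, 0 ≤ (1 - r i) * ((μ j - min (ν j) (μ j)) / D) := fun i j =>
      mul_nonneg (sub_nonneg.2 (hr1 i)) (div_nonneg (he j) hD0)
    have hmoved : ∑ i, ν i * (1 - r i) = D := by
      rw [hD']
      exact Finset.sum_congr rfl fun i _ => by rw [mul_sub, mul_one, hνr]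
    refine ⟨fun i j => (if i = j then r i else 0) + (1 - r i) * ((μ j - min (ν j) (μ j)) / D),
      fun i j => add_nonneg ?_ (hq i j), fun i => ?_, fun j => ?_, ?_⟩
    · split_ifs
      exacts [hr0 i, le_rfl]
    · rw [Finset.sum_add_distrib, ← Finset.mul_sum, ← Finset.sum_div, ← hD, div_self hpos.ne']
      simp
    · simp only [mul_add, Finset.sum_add_distrib, ← mul_assoc]
      rw [← Finset.sum_mul, hmoved, mul_div_cancel₀ _ hpos.ne']
      simp [hνr]
    · refine le_trans (Finset.sum_le_sum fun i _ => ?_) (hmoved.le.trans hDle)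
      refine mul_le_mul_of_nonneg_left ?_ (hν.1 i)
      have := hq i i
      simp only [if_true]
      linarith

/-- The mixture of finitely many graphs of functions, with weights depending on the base point. -/
theorem exists_mixture {Ω E Q : Type*} [MeasurableSpace Ω] [MeasurableSpace E] [Fintype Q]
    (G : Measure Ω) {k : Q → Ω → ENNReal} (hk : ∀ i, Measurable (k i)) {ξ : Q → Ω → E}
    (hξ : ∀ i, Measurable (ξ i)) :
    ∃ π : Measure (Ω × E), ∀ g : Ω × E → ENNReal, Measurable g →
      ∫⁻ p, g p ∂π = ∫⁻ w, ∑ i, k i w * g (w, ξ i w) ∂G := by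
  refine ⟨∑ i, (G.withDensity (k i)).map fun w => (w, ξ i w), fun g hg => ?_⟩
  have hm : ∀ i, Measurable fun w => (w, ξ i w) := fun i => measurable_id.prodMk (hξ i)
  have hkg : ∀ i, Measurable fun w => k i w * g (w, ξ i w) := fun i =>
    (hk i).mul (hg.comp (hm i))
  rw [lintegral_finsetSum_measure, lintegral_finsetSum _ fun i _ => hkg i]
  refine Finset.sum_congr rfl fun i _ => ?_
  rw [lintegral_map hg (hm i)]
  exact lintegral_withDensity_eq_lintegral_mul _ (hk i) (hg.comp (hm i))

/-- The law of a random variable with values in a finite type, as a probability vector. -/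
theorem map_real_singleton_mem_stdSimplex {Ω Q : Type*} [MeasurableSpace Ω] [Fintype Q]
    [MeasurableSpace Q] [MeasurableSingletonClass Q] (G : Measure Ω) [IsProbabilityMeasure G]
    {j : Ω → Q} (hj : Measurable j) :
    (fun q => (G.map j).real {q}) ∈ stdSimplex ℝ Q := by
  have := Measure.isProbabilityMeasure_map (μ := G) hj.aemeasurable
  refine ⟨fun q => measureReal_nonneg, ?_⟩
  rw [sum_measureReal_singleton]
  simp

/-- A random vector `Y`, seen as a perturbation of `V`, can be modified so that the node `idx Y` has
a prescribed law `μ`, at a cost controlled by the distance of `μ` to the law of `idx Y`. -/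
theorem exists_perturbation_of_law {Ω E Q : Type*} [MeasurableSpace Ω] [NormedAddCommGroup E]
    [NormedSpace ℝ E] [MeasurableSpace E] [BorelSpace E] [SecondCountableTopology E] [Fintype Q]
    [MeasurableSpace Q] [MeasurableSingletonClass Q]
    (G : Measure Ω) [IsProbabilityMeasure G] {idx : E → Q} (hidx : Measurable idx) {c : Q → E}
    (hc : ∀ q, idx (c q) = q) {Y V : Ω → E} (hY : Measurable Y) (hV : Measurable V)
    {R : Ω → ℝ} (hR : ∀ q w, ‖c q - Y w‖ ≤ R w) (hR2 : Integrable (fun w => R w ^ 2) G)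
    (hYV : Integrable (fun w => ‖Y w - V w‖) G) {θ κ : ℝ} (hθ : 0 < θ) (hκ : 0 < κ)
    {μ : Q → ℝ} (hμ : μ ∈ stdSimplex ℝ Q) :
    ∃ π : Measure (Ω × E), π.map Prod.fst = G ∧
      (∀ q, (π.map fun p => idx (V p.1 + θ • p.2)) {q} = ENNReal.ofReal (μ q)) ∧
      ∫⁻ p, ‖p.2‖ₑ ∂π ≤ ENNReal.ofReal (θ⁻¹ * (∫ w, ‖Y w - V w‖ ∂G + κ * ∫ w, R w ^ 2 ∂G +
        (4 * κ)⁻¹ * ∑ q, |(G.map fun w => idx (Y w)).real {q} - μ q|)) := by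
  classical
  have hj : Measurable fun w => idx (Y w) := hidx.comp hY
  set j : Ω → Q := fun w => idx (Y w) with hjdef
  have hprob := Measure.isProbabilityMeasure_map (μ := G) hj.aemeasurable
  obtain ⟨K, hK0, hK1, hKμ, hKD⟩ :=
    exists_stochastic_transport (map_real_singleton_mem_stdSimplex G hj) hμ
  -- The target point when node `i` is drawn: it always lies in node `i`, and is `Y w` itself when
  -- no move is needed.
  set Z : Q → Ω → E := fun i w => if j w = i then Y w else c i with hZ
  have hZm : ∀ i, Measurable (Z i) := fun i =>
    Measurable.ite (hj (measurableSet_singleton i)) hY measurable_const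
  have hZidx : ∀ i w, idx (Z i w) = i := fun i w => by
    simp only [hZ]
    split_ifs with h
    exacts [h, hc i]
  have hkm : ∀ i, Measurable fun w => ENNReal.ofReal (K (j w) i) := fun i =>
    (measurable_of_finite fun q => ENNReal.ofReal (K q i)).comp hj
  have hξm : ∀ i, Measurable fun w => θ⁻¹ • (Z i w - V w) := fun i =>
    ((hZm i).sub hV).const_smul _
  have hKsum : ∀ q, ∑ i, ENNReal.ofReal (K q i) = 1 := fun q => by
    rw [← ENNReal.ofReal_sum_of_nonneg fun i _ => hK0 q i, hK1, ENNReal.ofReal_one]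
  obtain ⟨π, hπ⟩ := exists_mixture G hkm hξm
  refine ⟨π, ?_, fun q => ?_, ?_⟩
  · ext s hs
    rw [Measure.map_apply measurable_fst hs, ← lintegral_indicator_one (measurable_fst hs),
      hπ _ (measurable_one.indicator (measurable_fst hs)), ← lintegral_indicator_one hs]
    refine lintegral_congr fun w => ?_
    by_cases hw : w ∈ s <;> simp [Set.indicator, hw, hKsum]
  · have hm : Measurable fun p : Ω × E => idx (V p.1 + θ • p.2) :=
      hidx.comp ((hV.comp measurable_fst).add (measurable_snd.const_smul θ))
    have hs := hm (measurableSet_singleton q)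
    rw [Measure.map_apply hm (measurableSet_singleton q), ← lintegral_indicator_one hs,
      hπ _ (measurable_one.indicator hs)]
    -- On the `i`-th graph `V + θ ξ` equals `Z i`, so the indicator selects `i = q`.
    have hpt : ∀ w, ∑ i, ENNReal.ofReal (K (j w) i) *
        ((fun p : Ω × E => idx (V p.1 + θ • p.2)) ⁻¹' {q}).indicator (1 : Ω × E → ENNReal)
          (w, θ⁻¹ • (Z i w - V w)) = ENNReal.ofReal (K (j w) q) := fun w => by
      simp [Set.indicator, smul_smul, mul_inv_cancel₀ hθ.ne', hZidx]
    simp_rw [hpt]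
    rw [← lintegral_map (f := fun i => ENNReal.ofReal (K i q)) (measurable_of_finite _) hj,
      lintegral_fintype, ← hKμ q, ENNReal.ofReal_sum_of_nonneg fun i _ =>
        mul_nonneg measureReal_nonneg (hK0 i q)]
    refine Finset.sum_congr rfl fun i _ => ?_
    rw [ENNReal.ofReal_mul measureReal_nonneg, ofReal_measureReal, mul_comm]
  · rw [hπ _ measurable_snd.enorm]
    have hK11 : ∀ q, K q q ≤ 1 := fun q =>
      hK1 q ▸ Finset.single_le_sum (fun i _ => hK0 q i) (Finset.mem_univ q)
    have hKint : Integrable (fun q => 1 - K q q) (G.map j) := Integrable.of_finite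
    have hKint' : Integrable (fun w => 1 - K (j w) (j w)) G :=
      hKint.comp_measurable hj
    have hint : Integrable (fun w => θ⁻¹ * (‖Y w - V w‖ + κ * R w ^ 2 +
        (4 * κ)⁻¹ * (1 - K (j w) (j w)))) G :=
      ((hYV.add (hR2.const_mul κ)).add (hKint'.const_mul _)).const_mul _
    have hpt : ∀ w, ∑ i, K (j w) i * ‖θ⁻¹ • (Z i w - V w)‖ ≤ θ⁻¹ * (‖Y w - V w‖ + κ * R w ^ 2 +
        (4 * κ)⁻¹ * (1 - K (j w) (j w))) := fun w => by
      have hR0 : 0 ≤ R w := (norm_nonneg _).trans (hR (j w) w)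
      have h1 : ∀ i, ‖Z i w - V w‖ ≤ ‖Y w - V w‖ + (R w - if j w = i then R w else 0) := fun i => by
        simp only [hZ]
        split_ifs with h
        · simp
        · have := norm_add_le (Y w - V w) (c i - Y w)
          rw [show Y w - V w + (c i - Y w) = c i - V w by abel] at this
          linarith [hR i w]
      have h2 : ∑ i, K (j w) i * ‖Z i w - V w‖ ≤ ‖Y w - V w‖ + (1 - K (j w) (j w)) * R w := by
        refine (Finset.sum_le_sum fun i _ => mul_le_mul_of_nonneg_left (h1 i) (hK0 _ i)).trans ?_
        simp only [mul_add, mul_sub, Finset.sum_add_distrib, Finset.sum_sub_distrib,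
          ← Finset.sum_mul, hK1, mul_ite, mul_zero, Finset.sum_ite_eq, Finset.mem_univ, if_true]
        linarith
      -- Young's inequality, with `a ^ 2 ≤ a` for the moving probability `a ∈ [0, 1]`. It separates
      -- the unbounded `R` from the moved mass.
      have h3 : (1 - K (j w) (j w)) * R w ≤ κ * R w ^ 2 + (4 * κ)⁻¹ * (1 - K (j w) (j w)) := by
        have ha := sub_nonneg.2 (hK11 (j w))
        have hb := hK0 (j w) (j w)
        set a := 1 - K (j w) (j w) with ha'
        have : κ * R w ^ 2 + (4 * κ)⁻¹ * a - a * R w =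
            κ⁻¹ * ((κ * R w - a / 2) ^ 2 + a * (1 - a) / 4) := by
          field_simp
          ring
        have h4 : 0 ≤ a * (1 - a) := mul_nonneg ha (by linarith)
        have : 0 ≤ κ⁻¹ * ((κ * R w - a / 2) ^ 2 + a * (1 - a) / 4) := by positivity
        linarith
      have h5 : ∀ i, K (j w) i * ‖θ⁻¹ • (Z i w - V w)‖ = θ⁻¹ * (K (j w) i * ‖Z i w - V w‖) :=
        fun i => by
          rw [norm_smul, Real.norm_eq_abs, abs_of_pos (inv_pos.2 hθ)]
          ring
      rw [Finset.sum_congr rfl fun i _ => h5 i, ← Finset.mul_sum]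
      refine mul_le_mul_of_nonneg_left ?_ (inv_pos.2 hθ).le
      linarith
    have hnn : ∀ w, 0 ≤ ∑ i, K (j w) i * ‖θ⁻¹ • (Z i w - V w)‖ := fun w =>
      Finset.sum_nonneg fun i _ => mul_nonneg (hK0 _ i) (norm_nonneg _)
    calc ∫⁻ w, ∑ i, ENNReal.ofReal (K (j w) i) * ‖θ⁻¹ • (Z i w - V w)‖ₑ ∂G
        ≤ ∫⁻ w, ENNReal.ofReal (θ⁻¹ * (‖Y w - V w‖ + κ * R w ^ 2 +
            (4 * κ)⁻¹ * (1 - K (j w) (j w)))) ∂G := by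
          refine lintegral_mono fun w => le_trans (le_of_eq ?_) (ENNReal.ofReal_le_ofReal (hpt w))
          rw [ENNReal.ofReal_sum_of_nonneg fun i _ => mul_nonneg (hK0 _ i) (norm_nonneg _)]
          refine Finset.sum_congr rfl fun i _ => ?_
          rw [ENNReal.ofReal_mul (hK0 _ i), ofReal_norm]
      _ = ENNReal.ofReal (∫ w, θ⁻¹ * (‖Y w - V w‖ + κ * R w ^ 2 +
            (4 * κ)⁻¹ * (1 - K (j w) (j w))) ∂G) :=
          (ofReal_integral_eq_lintegral_ofReal hint (.of_forall fun w => (hnn w).trans (hpt w))).symm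
      _ ≤ _ := by
          refine ENNReal.ofReal_le_ofReal ?_
          have hsum : Integrable (fun w => ‖Y w - V w‖ + κ * R w ^ 2) G := hYV.add (hR2.const_mul κ)
          rw [integral_const_mul, integral_add hsum (hKint'.const_mul _),
            integral_add hYV (hR2.const_mul κ), integral_const_mul, integral_const_mul]
          -- The mean moving probability is the mass moved by `K`, which `hKD` bounds by the `ℓ¹`
          -- distance.
          have : ∫ w, (1 - K (j w) (j w)) ∂G = ∑ q, (G.map j).real {q} * (1 - K q q) := by
            rw [← integral_map (f := fun q => 1 - K q q) hj.aemeasurable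
              (measurable_of_finite _).aestronglyMeasurable, integral_fintype hKint]
            rfl
          rw [this]
          gcongr

/-! ### Nodes of a rectangular partition -/

instance Sum.instMeasurableSingletonClass {α β : Type*} [MeasurableSpace α] [MeasurableSpace β]
    [MeasurableSingletonClass α] [MeasurableSingletonClass β] :
    MeasurableSingletonClass (α ⊕ β) := by
  refine ⟨?_⟩
  rintro (a | b)
  · rw [← Set.image_singleton]
    exact (measurableSet_singleton a).inl_image
  · rw [← Set.image_singleton]
    exact (measurableSet_singleton b).inr_image

open Classical in
/-- The node of a point: the index of the cell that contains it, or the out-of-domain node. -/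
noncomputable def cellIndex {n N : ℕ} (cells : Fin N → Set (Fin n → ℝ)) (x : Fin n → ℝ) :
    Fin N ⊕ Unit :=
  if h : ∃ j, x ∈ cells j then Sum.inl h.choose else Sum.inr ()

section Nodes

variable {n N : ℕ} {W : Set (Fin n → ℝ)} {cells : Fin N → Set (Fin n → ℝ)}

theorem IsRectPartition.eq_of_mem (h : IsRectPartition W cells) {i j : Fin N} {x : Fin n → ℝ}
    (hi : x ∈ cells i) (hj : x ∈ cells j) : i = j :=
  by_contra fun hij => Set.disjoint_left.1 (h.2.1 hij) hi hj

theorem IsRectPartition.subset (h : IsRectPartition W cells) (j : Fin N) : cells j ⊆ W :=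
  h.2.2 ▸ Set.subset_iUnion cells j

theorem IsRectPartition.cellIndex_eq_inl_iff (h : IsRectPartition W cells) {x : Fin n → ℝ}
    {j : Fin N} : cellIndex cells x = Sum.inl j ↔ x ∈ cells j := by
  unfold cellIndex
  split_ifs with hx
  · rw [Sum.inl.injEq]
    exact ⟨fun hj => hj ▸ hx.choose_spec, fun hj => h.eq_of_mem hx.choose_spec hj⟩
  · simpa using fun hj => hx ⟨j, hj⟩

theorem IsRectPartition.cellIndex_eq_inr_iff (h : IsRectPartition W cells) {x : Fin n → ℝ} :
    cellIndex cells x = Sum.inr () ↔ x ∉ W := by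
  unfold cellIndex
  rw [← h.2.2, Set.mem_iUnion]
  split_ifs with hx <;> simp [hx]

theorem IsRectPartition.measurable_cellIndex (h : IsRectPartition W cells) :
    Measurable (cellIndex cells) := by
  refine measurable_to_countable' ?_
  rintro (j | ⟨⟩)
  · convert (h.1 j).measurableSet using 1
    ext x
    exact h.cellIndex_eq_inl_iff
  · convert h.measurableSet.compl using 1
    ext x
    exact h.cellIndex_eq_inr_iff

theorem measurable_killOutside (hW : MeasurableSet W) : Measurable (killOutside W) := by
  classical
  exact Measurable.dite (s := W) (f := fun x => (Sum.inl x : W ⊕ Unit))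
    (g := fun _ => Sum.inr ()) measurable_inl measurable_const hW

/-- The node of a state. -/
noncomputable def stateNode (W : Set (Fin n → ℝ)) (cells : Fin N → Set (Fin n → ℝ)) :
    W ⊕ Unit → Fin N ⊕ Unit :=
  Sum.elim (fun x => cellIndex cells x) Sum.inr

/-- Since the cells are disjoint and cover `W`, the relation is the graph of a function. Agreement
on nodes thereby becomes a statement about pushforwards along `stateNode`. -/
theorem IsRectPartition.mem_partitionRel (h : IsRectPartition W cells) {z : W ⊕ Unit}
    {q : Fin N ⊕ Unit} : (z, q) ∈ partitionRel W cells ↔ stateNode W cells z = q := by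
  unfold partitionRel stateNode
  rcases z with z | ⟨⟩ <;> rcases q with j | ⟨⟩
  · simp [h.cellIndex_eq_inl_iff]
  · simp [h.cellIndex_eq_inr_iff]
  · simp
  · simp

theorem IsRectPartition.measurable_stateNode (h : IsRectPartition W cells) :
    Measurable (stateNode W cells) :=
  (h.measurable_cellIndex.comp measurable_subtype_coe).sumElim measurable_inr

theorem IsRectPartition.stateNode_killOutside (h : IsRectPartition W cells) (x : Fin n → ℝ) :
    stateNode W cells (killOutside W x) = cellIndex cells x := by
  unfold killOutside
  split_ifs with hx
  · rfl
  · exact (h.cellIndex_eq_inr_iff.2 hx).symm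

theorem IsRectPartition.agreeOnNodes_iff (h : IsRectPartition W cells)
    {ν : ProbabilityMeasure (W ⊕ Unit)} {μ : stdSimplex ℝ (Fin N ⊕ Unit)} :
    AgreeOnNodes (partitionRel W cells) ν μ ↔
      ∀ q, ((ν : Measure (W ⊕ Unit)).map (stateNode W cells)).real {q} = μ.1 q := by
  refine forall_congr' fun q => ?_
  rw [map_measureReal_apply h.measurable_stateNode (measurableSet_singleton q)]
  simp only [h.mem_partitionRel]
  rfl

/-- Every node contains a point, the out-of-domain node because the domain is bounded. -/
theorem IsRectPartition.exists_cellIndex_eq (h : IsRectPartition W cells) (hn : 1 ≤ n)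
    (q : Fin N ⊕ Unit) : ∃ x, cellIndex cells x = q := by
  rcases q with j | ⟨⟩
  · obtain ⟨x, hx⟩ := (h.1 j).nonempty
    exact ⟨x, h.cellIndex_eq_inl_iff.2 hx⟩
  -- For `n = 0` the whole space is one bounded point and could equal `W`; `n ≥ 1` makes it
  -- unbounded.
  · have : Nonempty (Fin n) := ⟨⟨0, hn⟩⟩
    have hW : W ≠ Set.univ := fun hW =>
      NormedSpace.unbounded_univ ℝ (Fin n → ℝ) (hW ▸ h.isBounded)
    obtain ⟨x, hx⟩ := (Set.ne_univ_iff_exists_notMem _).1 hW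
    exact ⟨x, h.cellIndex_eq_inr_iff.2 hx⟩

end Nodes

/-! ### Estimates -/

instance stdNormal.instIsProbabilityMeasure (k : ℕ) : IsProbabilityMeasure (stdNormal k) := by
  unfold stdNormal
  infer_instance

/-- The squared sup norm is at most the sum of squared coordinates, each with finite Gaussian second
moment, and `(1 + t) ^ 2 ≤ 2 + 2 * t ^ 2`. -/
theorem integrable_one_add_norm_sq_stdNormal (k : ℕ) :
    Integrable (fun w => (1 + ‖w‖) ^ 2) (stdNormal k) := by
  have h1 : ∀ i, Integrable (fun w : Fin k → ℝ => w i ^ 2) (stdNormal k) := fun i =>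
    (measurePreserving_eval (fun _ : Fin k => gaussianReal 0 1) i).integrable_comp_of_integrable
      (memLp_id_gaussianReal 2).integrable_sq
  refine ((integrable_const 2).add ((integrable_finsetSum Finset.univ fun i _ =>
    h1 i).const_mul 2)).mono' (by fun_prop) (.of_forall fun w => ?_)
  have hs : ‖w‖ ≤ √(∑ i, w i ^ 2) := by
    refine (pi_norm_le_iff_of_nonneg (Real.sqrt_nonneg _)).2 fun i => ?_
    rw [Real.norm_eq_abs]
    refine Real.abs_le_sqrt ?_
    exact Finset.single_le_sum (f := fun i => w i ^ 2) (fun i _ => sq_nonneg _) (Finset.mem_univ i)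
  have hs2 : ‖w‖ ^ 2 ≤ ∑ i, w i ^ 2 := by
    rw [← Real.sq_sqrt (Finset.sum_nonneg fun i _ => sq_nonneg (w i))]
    exact pow_le_pow_left₀ (norm_nonneg _) hs 2
  rw [Real.norm_eq_abs, abs_of_nonneg (sq_nonneg _)]
  simp only [Pi.add_apply]
  nlinarith [sq_nonneg (1 - ‖w‖)]

theorem integrable_one_add_norm_stdNormal (k : ℕ) :
    Integrable (fun w => 1 + ‖w‖) (stdNormal k) := by
  refine (integrable_one_add_norm_sq_stdNormal k).mono' (by fun_prop) (.of_forall fun w => ?_)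
  have := norm_nonneg w
  rw [Real.norm_eq_abs, abs_of_nonneg (by positivity)]
  nlinarith

theorem norm_mulVec_le_of_entries {n k : ℕ} {A : Matrix (Fin n) (Fin k) ℝ} {c : ℝ} (hc : 0 ≤ c)
    (hA : ∀ i j, |A i j| ≤ c) (w : Fin k → ℝ) : ‖A *ᵥ w‖ ≤ k * c * ‖w‖ := by
  refine (pi_norm_le_iff_of_nonneg (by positivity)).2 fun i => ?_
  calc ‖∑ j, A i j * w j‖ ≤ ∑ _j : Fin k, c * ‖w‖ :=
        (norm_sum_le _ _).trans <| Finset.sum_le_sum fun j _ => by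
          rw [norm_mul]
          exact mul_le_mul (hA i j) (norm_le_pi_norm w j) (norm_nonneg _) hc
    _ = k * c * ‖w‖ := by simp [mul_assoc]

section Coefficients

variable {n k : ℕ} {W : Set (Fin n → ℝ)} {f : (Fin n → ℝ) → (Fin n → ℝ)}
  {b : (Fin n → ℝ) → Matrix (Fin n) (Fin k) ℝ}

/-- Continuous coefficients have linear growth in the noise, uniformly on a bounded set. -/
theorem exists_bound_coefficients (hW : Bornology.IsBounded W) (hf : Continuous f)
    (hb : Continuous fun x (i : Fin n) (j : Fin k) => b x i j) :
    ∃ C, 0 ≤ C ∧ ∀ x ∈ W, ‖f x‖ ≤ C ∧ ∀ w, ‖b x *ᵥ w‖ ≤ C * ‖w‖ := by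
  obtain ⟨C₁, h₁⟩ := hW.isCompact_closure.exists_bound_of_continuousOn hf.continuousOn
  obtain ⟨C₂, h₂⟩ := hW.isCompact_closure.exists_bound_of_continuousOn hb.continuousOn
  refine ⟨max C₁ 0 + k * max C₂ 0, by positivity, fun x hx => ⟨?_, fun w => ?_⟩⟩
  · have : 0 ≤ k * max C₂ 0 := by positivity
    linarith [h₁ x (subset_closure hx), le_max_left C₁ 0]
  · refine (norm_mulVec_le_of_entries (le_max_right C₂ 0) (fun i j => ?_) w).trans ?_
    · have h := h₂ x (subset_closure hx)
      have hi := norm_le_pi_norm (fun (i : Fin n) (j : Fin k) => b x i j) i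
      have hj := norm_le_pi_norm (fun j : Fin k => b x i j) j
      exact (hj.trans (hi.trans h)).trans (le_max_left _ _)
    · exact mul_le_mul_of_nonneg_right (le_add_of_nonneg_left (le_max_right _ _)) (norm_nonneg _)

/-- Continuous coefficients are uniformly continuous on a bounded set. -/
theorem exists_modulus_coefficients (hW : Bornology.IsBounded W) (hf : Continuous f)
    (hb : Continuous fun x (i : Fin n) (j : Fin k) => b x i j) {ε : ℝ} (hε : 0 < ε) :
    ∃ δ > 0, ∀ x ∈ W, ∀ y ∈ W, dist x y ≤ δ →
      ‖f x - f y‖ ≤ ε ∧ ∀ w, ‖b x *ᵥ w - b y *ᵥ w‖ ≤ ε * ‖w‖ := by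
  obtain ⟨δ₁, hδ₁, h₁⟩ := Metric.uniformContinuousOn_iff_le.1
    (hW.isCompact_closure.uniformContinuousOn_of_continuous hf.continuousOn) ε hε
  -- Absorbs the factor `k` of `norm_mulVec_le_of_entries`; the `+ 1` allows `k = 0`.
  have hε' : 0 < ε / (k + 1) := by positivity
  obtain ⟨δ₂, hδ₂, h₂⟩ := Metric.uniformContinuousOn_iff_le.1
    (hW.isCompact_closure.uniformContinuousOn_of_continuous hb.continuousOn) _ hε'
  refine ⟨min δ₁ δ₂, lt_min hδ₁ hδ₂, fun x hx y hy hxy => ⟨?_, fun w => ?_⟩⟩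
  · rw [← dist_eq_norm]
    exact h₁ x (subset_closure hx) y (subset_closure hy) (hxy.trans (min_le_left _ _))
  · rw [← Matrix.sub_mulVec]
    refine (norm_mulVec_le_of_entries hε'.le (fun i j => ?_) w).trans ?_
    · have h := h₂ x (subset_closure hx) y (subset_closure hy) (hxy.trans (min_le_right _ _))
      have hi := dist_le_pi_dist (fun (i : Fin n) (j : Fin k) => b x i j) (fun i j => b y i j) i
      have hj := dist_le_pi_dist (fun j : Fin k => b x i j) (fun j => b y i j) j
      exact hj.trans (hi.trans h)
    · refine mul_le_mul_of_nonneg_right ?_ (norm_nonneg _)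
      rw [mul_div_assoc', div_le_iff₀ (by positivity)]
      nlinarith

end Coefficients

/-! ### Node laws and kernels realizing them -/

/-- The law of the node reached from `x` under the constant perturbation `u`. -/
noncomputable def nodeLaw {n k N : ℕ} (cells : Fin N → Set (Fin n → ℝ))
    (f : (Fin n → ℝ) → (Fin n → ℝ)) (b : (Fin n → ℝ) → Matrix (Fin n) (Fin k) ℝ) (ϑ : ℝ)
    (x u : Fin n → ℝ) (q : Fin N ⊕ Unit) : ℝ :=
  ((stdNormal k).map fun w => cellIndex cells (f x + b x *ᵥ w + ϑ • u)).real {q}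

section Perturbation

variable {n k N : ℕ} {W : Set (Fin n → ℝ)} {cells : Fin N → Set (Fin n → ℝ)}
  {f : (Fin n → ℝ) → (Fin n → ℝ)} {b : (Fin n → ℝ) → Matrix (Fin n) (Fin k) ℝ}

theorem IsRectPartition.nodeLaw_mem_stdSimplex (h : IsRectPartition W cells) (ϑ : ℝ)
    (x u : Fin n → ℝ) : nodeLaw cells f b ϑ x u ∈ stdSimplex ℝ (Fin N ⊕ Unit) :=
  map_real_singleton_mem_stdSimplex (stdNormal k)
    (h.measurable_cellIndex.comp (by fun_prop : Measurable fun w => f x + b x *ᵥ w + ϑ • u))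

/-- If the coefficients vary little on the cells, then every probability vector close to the node
law of a point mass perturbation at `x` is the node law of an `L¹`-perturbation of larger intensity
at any other point of the cell. -/
theorem IsRectPartition.exists_tolerance (h : IsRectPartition W cells) (hn : 1 ≤ n)
    (hf : Continuous f) (hb : Continuous fun x (i : Fin n) (j : Fin k) => b x i j) {ϑ₁ ϑ₂ ε : ℝ}
    (h0 : 0 ≤ ϑ₁) (h12 : ϑ₁ < ϑ₂)
    (hε : ε * ∫ w, (1 + ‖w‖) ∂(stdNormal k) ≤ (ϑ₂ - ϑ₁) / 3)
    (hcells : ∀ j, ∀ x ∈ cells j, ∀ y ∈ cells j,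
      ‖f x - f y‖ ≤ ε ∧ ∀ w, ‖b x *ᵥ w - b y *ᵥ w‖ ≤ ε * ‖w‖) :
    ∃ η > 0, ∀ j, ∀ x ∈ cells j, ∀ y ∈ cells j, ∀ u, ‖u‖ ≤ 1 →
      ∀ μ ∈ stdSimplex ℝ (Fin N ⊕ Unit), (∀ q, |nodeLaw cells f b ϑ₁ x u q - μ q| ≤ η) →
        ∃ π ∈ l1Perturbation n k, ∀ q,
          (π.map fun p => cellIndex cells (f y + b y *ᵥ p.1 + ϑ₂ • p.2)) {q} =
            ENNReal.ofReal (μ q) := by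
  choose c hc using h.exists_cellIndex_eq hn
  obtain ⟨C, hC0, hC⟩ := exists_bound_coefficients h.isBounded hf hb
  set Cc := ∑ q, ‖c q‖ with hCc
  have hcC : ∀ q, ‖c q‖ ≤ Cc := fun q =>
    Finset.single_le_sum (f := fun q => ‖c q‖) (fun i _ => norm_nonneg _) (Finset.mem_univ q)
  have hCc0 : 0 ≤ Cc := Finset.sum_nonneg fun q _ => norm_nonneg _
  set C' := Cc + C + ϑ₁ with hC'
  have hs : 0 < ϑ₂ - ϑ₁ := sub_pos.2 h12
  have hM := integrable_one_add_norm_stdNormal k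
  have hM2 := integrable_one_add_norm_sq_stdNormal k
  set M := ∫ w, (C' * (1 + ‖w‖)) ^ 2 ∂(stdNormal k) with hMdef
  have hM0 : 0 ≤ M := integral_nonneg fun w => sq_nonneg _
  -- Chosen so that the second-moment term `κ * M` costs at most a third of the surplus; `M + 1`
  -- avoids division by zero.
  set κ := (ϑ₂ - ϑ₁) / 3 / (M + 1) with hκdef
  have hκ : 0 < κ := by positivity
  have hκM : κ * M ≤ (ϑ₂ - ϑ₁) / 3 := by
    rw [hκdef, div_mul_eq_mul_div, div_le_iff₀ (by positivity)]
    exact mul_le_mul_of_nonneg_left (by linarith) (by positivity)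
  set D : ℝ := (Fintype.card (Fin N ⊕ Unit) : ℝ) with hD
  have hDpos : 0 < D := Nat.cast_pos.2 Fintype.card_pos
  -- With `D` nodes, an error of this size in each gives `(4 * κ)⁻¹` times the `ℓ¹` distance at most
  -- another third. The last third is the variation of the coefficients, from `hε`, and `ϑ₁` covers
  -- the term `ϑ₁ • u`.
  refine ⟨4 * κ * ((ϑ₂ - ϑ₁) / 3) / D, by positivity, fun j x hx y hy u hu μ hμ hclose => ?_⟩
  set Y : (Fin k → ℝ) → (Fin n → ℝ) := fun w => f x + b x *ᵥ w + ϑ₁ • u with hY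
  set V : (Fin k → ℝ) → (Fin n → ℝ) := fun w => f y + b y *ᵥ w with hV
  have hYm : Measurable Y := by fun_prop
  have hVm : Measurable V := by fun_prop
  have hu' : ‖ϑ₁ • u‖ ≤ ϑ₁ := by
    rw [norm_smul, Real.norm_eq_abs, abs_of_nonneg h0]
    exact mul_le_of_le_one_right h0 hu
  have hxW := hC x (h.subset j hx)
  have hR : ∀ q w, ‖c q - Y w‖ ≤ C' * (1 + ‖w‖) := fun q w => by
    have h1 := norm_sub_le (c q) (Y w)
    have h2 : ‖Y w‖ ≤ ‖f x‖ + ‖b x *ᵥ w‖ + ‖ϑ₁ • u‖ := norm_add₃_le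
    have h3 := hxW.2 w
    have h4 : 0 ≤ (Cc + ϑ₁) * ‖w‖ := by positivity
    rw [hC']
    linarith [hcC q, hxW.1]
  have hYV : ∀ w, ‖Y w - V w‖ ≤ ε * (1 + ‖w‖) + ϑ₁ := fun w => by
    have h1 : Y w - V w = (f x - f y) + (b x *ᵥ w - b y *ᵥ w) + ϑ₁ • u := by
      simp only [hY, hV]
      abel
    have h2 : ‖Y w - V w‖ ≤ ‖f x - f y‖ + ‖b x *ᵥ w - b y *ᵥ w‖ + ‖ϑ₁ • u‖ := h1 ▸ norm_add₃_le
    linarith [(hcells j x hx y hy).1, (hcells j x hx y hy).2 w]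
  have hbd : Integrable (fun w => ε * (1 + ‖w‖) + ϑ₁) (stdNormal k) :=
    (hM.const_mul ε).add (integrable_const ϑ₁)
  have hYVint : Integrable (fun w => ‖Y w - V w‖) (stdNormal k) :=
    hbd.mono' (hYm.sub hVm).norm.aestronglyMeasurable (.of_forall fun w => by
      rw [norm_norm]
      exact hYV w)
  have hYVle : ∫ w, ‖Y w - V w‖ ∂(stdNormal k) ≤ (ϑ₂ - ϑ₁) / 3 + ϑ₁ := by
    refine (integral_mono hYVint hbd hYV).trans ?_
    rw [integral_add (hM.const_mul ε) (integrable_const ϑ₁), integral_const_mul]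
    simpa using hε
  have hϑ₂ : 0 < ϑ₂ := h0.trans_lt h12
  obtain ⟨π, hπ1, hπ2, hπ3⟩ := exists_perturbation_of_law (stdNormal k) h.measurable_cellIndex hc
    hYm hVm hR (by simpa only [mul_pow] using hM2.const_mul (C' ^ 2)) hYVint hϑ₂ hκ hμ
  refine ⟨π, ⟨hπ1, hπ3.trans ?_⟩, hπ2⟩
  refine ENNReal.ofReal_le_one.2 ?_
  have hsum : ∑ q, |((stdNormal k).map fun w => cellIndex cells (Y w)).real {q} - μ q| ≤
      D * (4 * κ * ((ϑ₂ - ϑ₁) / 3) / D) := by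
    refine (Finset.sum_le_sum fun q _ => hclose q).trans ?_
    simp [hD]
  have hlast : (4 * κ)⁻¹ * ∑ q, |((stdNormal k).map fun w => cellIndex cells (Y w)).real {q} - μ q|
      ≤ (ϑ₂ - ϑ₁) / 3 := by
    rw [mul_div_cancel₀ _ hDpos.ne'] at hsum
    rw [inv_mul_le_iff₀ (by positivity)]
    exact hsum
  rw [inv_mul_le_iff₀ hϑ₂]
  linarith

/-- The unperturbed transition kernel is a transition kernel of the perturbed system. -/
theorem perturbedTransitions_l1Perturbation_nonempty (hW : MeasurableSet W) (hf : Continuous f)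
    (hb : Continuous fun x (i : Fin n) (j : Fin k) => b x i j) (ϑ : ℝ) :
    (perturbedTransitions W f b ϑ (l1Perturbation n k)).Nonempty := by
  have hkill := measurable_killOutside hW
  have hbm : Continuous b := hb
  have hg : Measurable fun p : W × (Fin k → ℝ) =>
      killOutside W (f p.1 + b p.1 *ᵥ p.2) := by
    refine hkill.comp (Continuous.measurable ?_)
    exact (hf.comp (continuous_subtype_val.comp continuous_fst)).add
      ((hbm.comp (continuous_subtype_val.comp continuous_fst)).matrix_mulVec continuous_snd)
  have hgx : ∀ x : W, Measurable fun w => killOutside W (f x + b x *ᵥ w) := fun x =>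
    hg.comp measurable_prodMk_left
  have hmeas : Measurable fun x : W =>
      (stdNormal k).map fun w => killOutside W (f x + b x *ᵥ w) := by
    refine Measure.measurable_of_measurable_coe _ fun s hs => ?_
    simp_rw [Measure.map_apply (hgx _) hs]
    -- Measurability in the state is that of the measure of the sections of a jointly measurable
    -- set.
    exact measurable_measure_prodMk_left (hg hs)
  refine ⟨⟨⟨Sum.elim (fun x : W => (stdNormal k).map fun w => killOutside W (f x + b x *ᵥ w))
    (fun _ => Measure.dirac (Sum.inr ())), hmeas.sumElim measurable_const⟩, ⟨?_⟩⟩,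
    fun x => ⟨(stdNormal k).prod (Measure.dirac 0), ⟨?_, ?_⟩, ?_⟩, rfl⟩
  · rintro (x | ⟨⟩)
    · exact Measure.isProbabilityMeasure_map (hgx x).aemeasurable
    · exact Measure.dirac.isProbabilityMeasure
  · rw [← Measure.fst, Measure.fst_prod]
  · rw [lintegral_prod _ (by fun_prop)]
    simp
  · have hm : Measurable fun p : (Fin k → ℝ) × (Fin n → ℝ) =>
        killOutside W (f x + b x *ᵥ p.1 + ϑ • p.2) := hkill.comp (by fun_prop)
    rw [Measure.prod_dirac, Measure.map_map hm (by fun_prop)]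
    change (stdNormal k).map (fun w => killOutside W (f x + b x *ᵥ w)) = _
    congr 1
    ext w : 1
    simp

/-- The law of one transition can be prescribed. -/
theorem exists_mem_perturbedTransitions (hW : MeasurableSet W) (hf : Continuous f)
    (hb : Continuous fun x (i : Fin n) (j : Fin k) => b x i j) (ϑ : ℝ) (y : W)
    {π : Measure ((Fin k → ℝ) × (Fin n → ℝ))} (hπ : π ∈ l1Perturbation n k) :
    ∃ T ∈ perturbedTransitions W f b ϑ (l1Perturbation n k),
      T.1 (Sum.inl y) = π.map fun p => killOutside W (f y + b y *ᵥ p.1 + ϑ • p.2) := by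
  classical
  obtain ⟨⟨κ, hκ⟩, hT⟩ := perturbedTransitions_l1Perturbation_nonempty hW hf hb ϑ
  have hmap : Measurable fun p : (Fin k → ℝ) × (Fin n → ℝ) =>
      killOutside W (f y + b y *ᵥ p.1 + ϑ • p.2) :=
    (measurable_killOutside hW).comp (by fun_prop)
  have hπprob : IsProbabilityMeasure π := ⟨by
    rw [← Set.preimage_univ (f := Prod.fst), ← Measure.map_apply measurable_fst MeasurableSet.univ,
      hπ.1, measure_univ]⟩
  have hprob := Measure.isProbabilityMeasure_map (μ := π) hmap.aemeasurable
  -- Apart from measurability, admissibility does not link different states, so the unperturbed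
  -- kernel may be altered at the single state `y`.
  refine ⟨⟨Kernel.piecewise (measurableSet_singleton (Sum.inl y))
    (Kernel.const _ (π.map fun p => killOutside W (f y + b y *ᵥ p.1 + ϑ • p.2))) κ,
    inferInstance⟩, ⟨fun x => ?_, ?_⟩, ?_⟩
  · rw [Kernel.piecewise_apply]
    split_ifs with hx
    · obtain rfl : x = y := Sum.inl_injective hx
      exact ⟨π, hπ, rfl⟩
    · exact hT.1 x
  · rw [Kernel.piecewise_apply, if_neg (by simp)]
    exact hT.2
  · rw [Kernel.piecewise_apply, if_pos (Set.mem_singleton _), Kernel.const_apply]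

end Perturbation

/-! ### Interval bounds and the abstraction -/

/-- A bounded set of vectors is covered by finitely many order boxes, all of whose points are close
to the set. -/
theorem exists_finset_box_cover {Q : Type*} [Fintype Q] {S : Set (Q → ℝ)}
    (hS : Bornology.IsBounded S) {η : ℝ} (hη : 0 < η) :
    ∃ B : Finset ((Q → ℝ) × (Q → ℝ)),
      (∀ v ∈ S, ∃ p ∈ B, ∀ q, p.1 q ≤ v q ∧ v q ≤ p.2 q) ∧
      ∀ p ∈ B, ∀ μ : Q → ℝ, (∀ q, p.1 q ≤ μ q ∧ μ q ≤ p.2 q) →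
        ∃ v ∈ S, ∀ q, |v q - μ q| ≤ η := by
  classical
  -- The centres are taken in `S` itself, so that each point of a box is `η`-close to an actual
  -- element of `S`.
  obtain ⟨t, htS, htf, hcov⟩ := (hS.isCompact_closure.totallyBounded.subset
    subset_closure).exists_subset (Metric.dist_mem_uniformity hη)
  refine ⟨htf.toFinset.image fun v => (fun q => v q - η, fun q => v q + η), fun v hv => ?_,
    fun p hp μ hμ => ?_⟩
  · obtain ⟨v', hv', hd⟩ := Set.mem_iUnion₂.1 (hcov hv)
    refine ⟨_, Finset.mem_image_of_mem _ (htf.mem_toFinset.2 hv'), fun q => ?_⟩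
    have := abs_le.1 ((dist_le_pi_dist v v' q).trans (le_of_lt hd))
    constructor <;> dsimp only <;> linarith [this.1, this.2]
  · obtain ⟨v, hv, rfl⟩ := Finset.mem_image.1 hp
    refine ⟨v, htS (htf.mem_toFinset.1 hv), fun q => abs_le.2 ?_⟩
    have := hμ q
    dsimp only at this
    constructor <;> linarith [this.1, this.2]

theorem isBounded_of_subset_stdSimplex {Q : Type*} [Fintype Q] {S : Set (Q → ℝ)}
    (hS : S ⊆ stdSimplex ℝ Q) : Bornology.IsBounded S :=
  (isCompact_stdSimplex ℝ Q).isBounded.subset hS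

section Abstraction

variable {n k N : ℕ} {W : Set (Fin n → ℝ)} {cells : Fin N → Set (Fin n → ℝ)}
  {f : (Fin n → ℝ) → (Fin n → ℝ)} {b : (Fin n → ℝ) → Matrix (Fin n) (Fin k) ℝ}

theorem IsRectPartition.exists_of_stateNode_eq_inl (h : IsRectPartition W cells) {z : W ⊕ Unit}
    {j : Fin N} (hz : stateNode W cells z = Sum.inl j) :
    ∃ x : W, z = Sum.inl x ∧ (x : Fin n → ℝ) ∈ cells j := by
  rcases z with x | ⟨⟩
  · exact ⟨x, rfl, h.cellIndex_eq_inl_iff.1 hz⟩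
  · simp [stateNode] at hz

theorem IsRectPartition.eq_of_stateNode_eq_inr (h : IsRectPartition W cells) {z : W ⊕ Unit}
    (hz : stateNode W cells z = Sum.inr ()) : z = Sum.inr () := by
  rcases z with x | ⟨⟩
  · exact absurd x.2 (h.cellIndex_eq_inr_iff.1 hz)
  · rfl

theorem IsRectPartition.map_stateNode_map (h : IsRectPartition W cells) (y : Fin n → ℝ) (ϑ : ℝ)
    (π : Measure ((Fin k → ℝ) × (Fin n → ℝ))) :
    (π.map fun p => killOutside W (f y + b y *ᵥ p.1 + ϑ • p.2)).map (stateNode W cells) =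
      π.map fun p => cellIndex cells (f y + b y *ᵥ p.1 + ϑ • p.2) := by
  have hm : Measurable fun p : (Fin k → ℝ) × (Fin n → ℝ) =>
      killOutside W (f y + b y *ᵥ p.1 + ϑ • p.2) :=
    (measurable_killOutside h.measurableSet).comp (by fun_prop)
  rw [Measure.map_map h.measurable_stateNode hm]
  simp only [Function.comp_def, h.stateNode_killOutside]

theorem IsRectPartition.exists_nodeLaw_eq (h : IsRectPartition W cells) {ϑ : ℝ}
    {T : MarkovTransition (W ⊕ Unit)}
    (hT : T ∈ perturbedTransitions W f b ϑ (pointMassPerturbation n k)) (x : W) :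
    ∃ u, ‖u‖ ≤ 1 ∧ (fun q => ((T.1 (Sum.inl x)).map (stateNode W cells)).real {q}) =
      nodeLaw cells f b ϑ x u := by
  obtain ⟨_, ⟨u, hu, rfl⟩, hTx⟩ := hT.1 x
  refine ⟨u, hu, ?_⟩
  have hm : Measurable fun p : (Fin k → ℝ) × (Fin n → ℝ) =>
      cellIndex cells (f x + b x *ᵥ p.1 + ϑ • p.2) :=
    h.measurable_cellIndex.comp (by fun_prop)
  ext q
  rw [hTx, h.map_stateNode_map, Measure.prod_dirac, Measure.map_map hm (by fun_prop)]
  rfl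

theorem IsRectPartition.map_stateNode_dirac (h : IsRectPartition W cells) :
    (fun q => ((Measure.dirac (Sum.inr () : W ⊕ Unit)).map (stateNode W cells)).real {q}) =
      Pi.single (Sum.inr ()) 1 := by
  ext q
  rw [map_measureReal_apply h.measurable_stateNode (measurableSet_singleton q), measureReal_def,
    Measure.dirac_apply' _ (h.measurable_stateNode (measurableSet_singleton q))]
  rcases q with j | ⟨⟩ <;> simp [stateNode]

end Abstraction

theorem mainTheorem3 {n k : ℕ} (hn : 1 ≤ n) {AP : Type*} [Finite AP]
    (W : Set (Fin n → ℝ)) (f : (Fin n → ℝ) → (Fin n → ℝ))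
    (b : (Fin n → ℝ) → Matrix (Fin n) (Fin k) ℝ)
    (hf : LocallyLipschitz f)
    (hb : LocallyLipschitz (fun x (i : Fin n) (j : Fin k) => b x i j))
    (L : W ⊕ Unit → Set AP) (hL : Measurable L) (hpart : AmenableToRectPartition W L)
    (x₀ : W ⊕ Unit) (ϑ₁ ϑ₂ : ℝ) (h0 : 0 ≤ ϑ₁) (h12 : ϑ₁ < ϑ₂) :
    ∃ (N : ℕ) (cells : Fin N → Set (Fin n → ℝ))
      (γ : SetRel (ProbabilityMeasure (W ⊕ Unit)) (stdSimplex ℝ (Fin N ⊕ Unit)))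
      (I : FiniteMarkovSystem (Fin N ⊕ Unit) AP),
      IsRectPartition W cells ∧
      (∀ ν μ, (ν, μ) ∈ γ → AgreeOnNodes (partitionRel W cells) ν μ) ∧
      I.HasIntervalRows ∧
      (x₀, I.init) ∈ partitionRel W cells ∧
      AbstractedByFinite
        (perturbedSystem W f b ϑ₁ (pointMassPerturbation n k) x₀ L hL)
        I (partitionRel W cells) γ ∧
      FiniteAbstractedBy I
        (perturbedSystem W f b ϑ₂ (l1Perturbation n k) x₀ L hL)
        (partitionRel W cells) γ.inv := by
  classical
  obtain ⟨N₀, cells₀, h₀, hL₀⟩ := hpart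
  have hfc := hf.continuous
  have hbc := hb.continuous
  have hs : 0 < ϑ₂ - ϑ₁ := sub_pos.2 h12
  set M := ∫ w, (1 + ‖w‖) ∂(stdNormal k) with hM
  have hM0 : 0 ≤ M := integral_nonneg fun w => add_nonneg zero_le_one (norm_nonneg w)
  have hε : (ϑ₂ - ϑ₁) / 3 / (M + 1) * M ≤ (ϑ₂ - ϑ₁) / 3 := by
    rw [div_mul_eq_mul_div, div_le_iff₀ (by positivity)]
    exact mul_le_mul_of_nonneg_left (by linarith) (by positivity)
  obtain ⟨δ, hδ, hδW⟩ := exists_modulus_coefficients h₀.isBounded hfc hbc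
    (show 0 < (ϑ₂ - ϑ₁) / 3 / (M + 1) by positivity)
  obtain ⟨N, cells, h, hsub, hdiam⟩ := h₀.exists_refinement hδ
  obtain ⟨η, hη, htol⟩ := h.exists_tolerance hn hfc hbc h0 h12 hε fun j x hx y hy =>
    hδW x (h.subset j hx) y (h.subset j hy) (hdiam j x hx y hy)
  set S : Fin N → Set (Fin N ⊕ Unit → ℝ) := fun j =>
    {v | ∃ x ∈ cells j, ∃ u, ‖u‖ ≤ 1 ∧ v = nodeLaw cells f b ϑ₁ x u} with hS
  choose B hB₁ hB₂ using fun j => exists_finset_box_cover (S := S j)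
    (isBounded_of_subset_stdSimplex (by
      rintro _ ⟨x, -, u, -, rfl⟩
      exact h.nodeLaw_mem_stdSimplex ϑ₁ x u)) hη
  -- The row of the absorbing node is pinned by equal lower and upper bounds.
  set e : Fin N ⊕ Unit → ℝ := Pi.single (Sum.inr ()) 1 with he
  set bounds : Fin N ⊕ Unit → Finset ((Fin N ⊕ Unit → ℝ) × (Fin N ⊕ Unit → ℝ)) :=
    Sum.elim B fun _ => {(e, e)} with hbounds
  choose r hr using h.exists_cellIndex_eq hn
  set rep : Fin N ⊕ Unit → W ⊕ Unit := fun q => killOutside W (r q) with hrep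
  have hrepq : ∀ q, stateNode W cells (rep q) = q := fun q =>
    (h.stateNode_killOutside _).trans (hr q)
  set I : FiniteMarkovSystem (Fin N ⊕ Unit) AP :=
    { transitions := {Θ | ∀ i, ∃ p ∈ bounds i, ∀ j, p.1 j ≤ Θ.1 i j ∧ Θ.1 i j ≤ p.2 j}
      init := stateNode W cells x₀
      label := fun q => L (rep q) } with hI
  have hlabel : ∀ z q, stateNode W cells z = q → L (rep q) = L z := by
    rintro z (j | ⟨⟩) hz
    · obtain ⟨x, rfl, hx⟩ := h.exists_of_stateNode_eq_inl hz
      obtain ⟨y, hy, hy'⟩ := h.exists_of_stateNode_eq_inl (hrepq (Sum.inl j))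
      obtain ⟨i, hi⟩ := hsub j
      rw [hy]
      exact hL₀ i y x (hi hy') (hi hx)
    · rw [h.eq_of_stateNode_eq_inr hz, h.eq_of_stateNode_eq_inr (hrepq (Sum.inr ()))]
  refine ⟨N, cells, {p | AgreeOnNodes (partitionRel W cells) p.1 p.2}, I, h, fun ν μ hνμ => hνμ,
    ⟨bounds, rfl⟩, h.mem_partitionRel.2 rfl,
    ⟨⟨fun z => ⟨_, h.mem_partitionRel.2 rfl⟩, fun z q hz => hlabel z q (h.mem_partitionRel.1 hz)⟩,
      fun i T hT x hx => ?_⟩,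
    ⟨⟨fun z => ⟨_, h.mem_partitionRel.2 rfl⟩, fun z q hz => hlabel z q (h.mem_partitionRel.1 hz)⟩,
      fun i Θ hΘ x hx => ?_⟩⟩
  · have hx := h.mem_partitionRel.1 hx
    -- Every row of the matrix must obey the bounds, not only row `i`. Row `i` is read off at `x`,
    -- the others at representatives, all from the same kernel `T`.
    set z : Fin N ⊕ Unit → W ⊕ Unit := Function.update rep i x with hz
    have hzq : ∀ q, stateNode W cells (z q) = q := fun q => by
      rcases eq_or_ne q i with rfl | hq
      · rw [hz, Function.update_self, hx]
      · rw [hz, Function.update_of_ne hq, hrepq]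
    have hprob : ∀ z, IsProbabilityMeasure (T.1 z) := T.2.isProbabilityMeasure
    set Θ : Fin N ⊕ Unit → Fin N ⊕ Unit → ℝ := fun q q' =>
      ((T.1 (z q)).map (stateNode W cells)).real {q'} with hΘ
    have hΘs : ∀ q, Θ q ∈ stdSimplex ℝ (Fin N ⊕ Unit) := fun q =>
      map_real_singleton_mem_stdSimplex (T.1 (z q)) h.measurable_stateNode
    have hagree : AgreeOnNodes (partitionRel W cells) (T.law x) (stochasticRow
        ⟨Matrix.of Θ, Matrix.mem_rowStochastic_iff_sum.2
          ⟨fun q q' => (hΘs q).1 q', fun q => (hΘs q).2⟩⟩ i) := by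
      refine h.agreeOnNodes_iff.2 fun q => ?_
      change ((T.1 x).map (stateNode W cells)).real {q} = Θ i q
      simp only [hΘ, hz, Function.update_self]
    refine ⟨_, fun q => ?_, hagree, hagree⟩
    change ∃ p ∈ bounds q, ∀ j, p.1 j ≤ Θ q j ∧ Θ q j ≤ p.2 j
    rcases q with j | ⟨⟩
    · obtain ⟨y, hy, hyj⟩ := h.exists_of_stateNode_eq_inl (hzq (Sum.inl j))
      obtain ⟨u, hu, huy⟩ := h.exists_nodeLaw_eq hT y
      refine hB₁ j _ ⟨y, hyj, u, hu, ?_⟩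
      rw [← huy, ← hy]
    · have hΔ : Θ (Sum.inr ()) = e := by
        rw [he, ← h.map_stateNode_dirac, ← hT.2,
          ← h.eq_of_stateNode_eq_inr (hzq (Sum.inr ()))]
      exact ⟨(e, e), Finset.mem_singleton_self _, fun j => by simp [hΔ]⟩
  · have hx := h.mem_partitionRel.1 hx
    obtain ⟨p, hp, hpΘ⟩ := hΘ i
    suffices ∃ T ∈ perturbedTransitions W f b ϑ₂ (l1Perturbation n k),
        ∀ q, ((T.1 x).map (stateNode W cells)).real {q} = Θ.1 i q by
      obtain ⟨T, hT, hTx⟩ := this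
      have hagree : AgreeOnNodes (partitionRel W cells) (T.law x) (stochasticRow Θ i) :=
        h.agreeOnNodes_iff.2 hTx
      exact ⟨T, hT, hagree, hagree⟩
    rcases i with j | ⟨⟩
    · obtain ⟨y, rfl, hy⟩ := h.exists_of_stateNode_eq_inl hx
      -- The nearby node law may come from another point `x` of the cell; the tolerance `η` is
      -- uniform over such pairs.
      obtain ⟨_, ⟨x, hxj, u, hu, rfl⟩, hclose⟩ := hB₂ j p hp _ hpΘ
      obtain ⟨π, hπ, hπq⟩ := htol j x hxj y hy u hu _ (stochasticRow Θ (Sum.inl j)).2 hclose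
      obtain ⟨T, hT, hTy⟩ := exists_mem_perturbedTransitions h.measurableSet hfc hbc ϑ₂ y hπ
      refine ⟨T, hT, fun q => ?_⟩
      rw [hTy, h.map_stateNode_map, measureReal_def, hπq, ENNReal.toReal_ofReal]
      · rfl
      · exact (stochasticRow Θ (Sum.inl j)).2.1 q
    · obtain rfl := h.eq_of_stateNode_eq_inr hx
      obtain rfl := Finset.mem_singleton.1 hp
      -- At `Δ` any admissible kernel works, as all of them are absorbing there.
      obtain ⟨T, hT⟩ := perturbedTransitions_l1Perturbation_nonempty h.measurableSet hfc hbc ϑ₂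
      refine ⟨T, hT, fun q => ?_⟩
      rw [hT.2, ← le_antisymm (hpΘ q).1 (hpΘ q).2]
      exact congrFun h.map_stateNode_dirac q
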